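/- For an integer $k$ with $0<k<|V(G)|$, a finite simple graph $G$ is called $k$-factor-critical if deleting any $k$ vertices of $G$ leaves a graph with a perfect matching. It is minimally $k$-factor-critical if it is $k$-factor-critical but, for every edge $e$ of $G$, the graph $G-e$ is not $k$-factor-critical. Theorem. Let $n\ge 11$ and let $G$ be a minimally $(n-6)$-factor-critical graph of order $n$ with maximum degree $\Delta(G)=n-4$. Then $G$ has at most four vertices of degree $n-4$, and every other vertex of $G$ has degree $n-5$. Moreover, $G$ contains no induced path of length three (an induced path on four vertices) all of whose vertices have degree $n-4$. -/

import Mathlib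

namespace SimpleGraph

/-- A graph `G` is `k`-factor-critical, for a positive integer `k` smaller than its order, if the
removal of any `k` vertices results in a graph with a perfect matching. -/
def IsFactorCritical {V : Type*} [Fintype V] (G : SimpleGraph V) (k : ℕ) : Prop :=
  0 < k ∧ k < Fintype.card V ∧
    ∀ S : Finset V, S.card = k →
      ∃ M : (G.induce ((S : Set V)ᶜ)).Subgraph, M.IsPerfectMatching

/-- A graph `G` is minimally `k`-factor-critical if it is `k`-factor-critical but `G - e` is not,
for any edge `e` of `G`. -/
def IsMinimallyFactorCritical {V : Type*} [Fintype V] (G : SimpleGraph V) (k : ℕ) : Prop :=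
  G.IsFactorCritical k ∧ ∀ e ∈ G.edgeSet, ¬ (G.deleteEdges {e}).IsFactorCritical k

end SimpleGraph

/-! Pass to the complement `H` of `G`. Deleting `n - 6` vertices leaves six, so factor-criticality
means that `G` has a perfect matching on every set of six vertices. By Tutte's theorem a graph on
six vertices has none exactly when its complement contains `K_{1,5}`, `K_{3,3}`, `K_{1,1,3}` or
`K_4`. Hence `H` avoids these four graphs, and minimality means that joining any two nonadjacent
vertices of `H` creates one of them. The implications needed are proved directly.

Let `T` be the set of vertices of degree `n - 4` in `G`, that is, of degree 3 in `H`. Without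
`K_{1,5}` the degrees in `H` are at most 4, which settles the degrees of the other vertices. Joining
two vertices of `T` cannot create a `K_{1,5}`, so it creates one of the other three graphs
(`isSaturated_compl`).

These conditions are local, and bounded degrees keep the case analysis finite. A search, sound by
`refute_sound` and evaluated by the kernel, excludes an induced path on four vertices inside `T`
and, once `T` has five vertices, both a triangle and an independent triple inside `T`. Five vertices
with neither contain an induced path on four vertices (`exists_induced_path`), so `T` has at most
four. The path on four vertices is self-complementary, which carries its exclusion back to `G`. -/

namespace SimpleGraph.Search

/-! ### The search, as a computation on bit sets -/

/-- `f n`, arranged so that the kernel evaluates `n` to a literal first. -/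
def force {α : Type} (n : ℕ) (f : ℕ → α) : α :=
  Nat.rec (motive := fun _ => α) (f 0) (fun k _ => f k.succ) n

/-- `f i` holds for all `i < n`. -/
def allBelow (f : ℕ → Bool) (n : ℕ) : Bool :=
  Nat.rec (motive := fun _ => Bool) true (fun k ih => cond (f k) ih false) n

/-- The `j`-th binary digit of `x`. -/
def bit (x j : ℕ) : Bool := (Nat.land (Nat.shiftRight x j) 1).beq 1

/-- The relation on `ℕ` coded by `E`, read off row by row with rows of length 32. -/
def adj (E i j : ℕ) : Bool := bit E (Nat.add (Nat.mul 32 i) j)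

/-- Add the pairs `(i, j)` and `(j, i)` to the relation coded by `E`. -/
def link (E i j : ℕ) : ℕ :=
  Nat.lor E (Nat.lor (Nat.pow 2 (Nat.add (Nat.mul 32 i) j)) (Nat.pow 2 (Nat.add (Nat.mul 32 j) i)))

/-- The bit set of the `j < 32` related to `i`. -/
def row (E i : ℕ) : ℕ := Nat.mod (Nat.shiftRight E (Nat.mul 32 i)) 4294967296

/-- The number has at most `k` nonzero binary digits. -/
def atMost (k : ℕ) : ℕ → Bool :=
  Nat.rec (motive := fun _ => ℕ → Bool) (fun x => x.beq 0)
    (fun _ ih x => force (Nat.land x x.pred) ih) k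

/-- The degree bound at the vertex `i` when the first `t` vertices have degree three. -/
def cap (t i : ℕ) : ℕ := cond (i.succ.ble t) 3 4

/-- No forbidden subgraph uses `i` and `j < i`, with set of common neighbours `c`, on one side. -/
def pairOk (m E i j c : ℕ) : Bool :=
  cond (c.beq 0) true <|
    -- Three tests: `K_{3,3}` here; for adjacent `i`, `j`, then `K_{1,1,3}` and `K_4`.
    cond (allBelow (fun k => atMost 2 (Nat.land c (row E k))) j)
      (cond (adj E i j)
        (cond (atMost 2 c) (allBelow (fun k => cond (bit c k) ((Nat.land c (row E k)).beq 0) true) m)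
          false)
        true)
      false

/-- The graph coded by `E` obeys the degree bounds and has no forbidden subgraph. -/
def consistent (t m E : ℕ) : Bool :=
  allBelow (fun i => force (row E i) fun x => cond (atMost (cap t i) x)
    (allBelow (fun j => force (Nat.land x (row E j)) fun c => pairOk m E i j c) i) false) m

/-- Fold `g` over `0, …, n - 1`. -/
def collect {α : Type} (g : ℕ → List α → List α) (n : ℕ) : List α :=
  Nat.rec (motive := fun _ => List α) [] g n

/-- All ways to complete the tuple `p` along the pattern `P`, adding edges to `E` and possibly vertices to
the `m` present ones, while avoiding the pairs in `N`. -/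
def extend (t N : ℕ) (P : List (List ℕ)) : ℕ → ℕ → List ℕ → List (ℕ × ℕ) :=
  List.rec (motive := fun _ => ℕ → ℕ → List ℕ → List (ℕ × ℕ))
    (fun m E _ => cond (consistent t m E) [(m, E)] [])
    (fun r _ ih m E p =>
      -- Mask of admissible `w`, starting from 32 ones: a vertex whose degree is exhausted admits
      -- only its recorded neighbours. The index `w = m` stands for a new vertex.
      force (r.foldr (fun i a =>
        cond (atMost (cap t (p.getD i 0)).pred (row E (p.getD i 0))) a
          (Nat.land a (row E (p.getD i 0)))) 4294967295) fun a =>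
      collect
        (fun w acc =>
          cond (bit a w)
            (cond (p.any w.beq) acc <|
              cond (r.any fun i => adj N (p.getD i 0) w) acc <|
              force (r.foldr (fun i E => link E (p.getD i 0) w) E) fun E' =>
              cond (atMost (cap t w) (row E' w))
                ((force (cond (w.beq m) m.succ m) fun m' => ih m' E' (p ++ [w])) ++ acc) acc)
            acc)
        m.succ)
    P

/-- The ways in which joining `u` and `v`, the first two entries of the tuple, can create a complete
graph on four vertices, a `K_{1,1,3}` or a `K_{3,3}`. -/
def patterns : List (List (List ℕ)) :=
  [[[0, 1], [0, 1, 2]], [[0, 1], [0, 1], [0, 1]], [[0, 1], [0, 2], [0, 2]],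
    [[0, 1], [1, 2], [1, 2]], [[0], [0], [1, 2, 3], [1, 2, 3]]]

/-- Remove duplicates. -/
def nub : List (ℕ × ℕ) → List (ℕ × ℕ)
  | [] => []
  | a :: l => cond (l.any fun b => cond (a.2.beq b.2) (a.1.beq b.1) false) (nub l) (a :: nub l)

/-- All completions of a pattern at the pair `u`, `v`. -/
def options (t N m E u v : ℕ) : List (ℕ × ℕ) :=
  nub (patterns.flatMap fun P => extend t N P m E [u, v])

/-- Search through the pairs listed: each is an edge or completes one of the patterns. The value is
`true` if every branch becomes inconsistent. -/
def refute (t : ℕ) : List (ℕ × ℕ) → ℕ → ℕ → ℕ → Bool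
  | [], _, _, _ => false
  | (u, v) :: l, m, E, N =>
    -- A pattern adds at most four vertices, which must fit into rows of length 32.
    cond (m.ble 28) (cond (adj E u v) (refute t l m E N) <|
      cond (cond (adj N u v) true <| force (link E u v) fun E' =>
          cond (consistent t m E') (refute t l m E' N) true)
        (force (link N u v) fun N' =>
          -- If some completion adds no edge, branching gains nothing: refuting the present state
          -- covers all completions.
          cond ((options t N' m E u v).any fun a => a.2.beq E) (refute t l m E N')
          ((options t N' m E u v).all fun a => refute t l a.1 a.2 N')) false) false

end SimpleGraph.Search

/-! ### Meaning of the bit operations and of the consistency test -/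

namespace SimpleGraph.Search

variable {V : Type*} {H : SimpleGraph V} {T : Set V} {t m E N : ℕ} {f : ℕ → V}

theorem force_eq {α : Type} (n : ℕ) (f : ℕ → α) : force n f = f n := by
  cases n <;> rfl

theorem allBelow_eq_true (f : ℕ → Bool) (n : ℕ) (h : ∀ i < n, f i = true) :
    allBelow f n = true := by
  induction n with
  | zero => rfl
  | succ n ih =>
    change cond (f n) (allBelow f n) false = true
    rw [h n n.lt_succ_self, ih fun i hi => h i (by omega)]
    rfl

theorem bit_eq_testBit (x j : ℕ) : bit x j = x.testBit j := by
  change Nat.beq ((x >>> j) &&& 1) 1 = _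
  rw [Nat.testBit, Nat.and_comm]
  have : 1 &&& x >>> j = 0 ∨ 1 &&& x >>> j = 1 := by
    have := @Nat.and_le_left 1 (x >>> j)
    omega
  rcases this with h | h <;> rw [h] <;> rfl

theorem adj_eq_testBit (E i j : ℕ) : adj E i j = E.testBit (32 * i + j) := bit_eq_testBit _ _

theorem testBit_row (E i j : ℕ) : (row E i).testBit j = (decide (j < 32) && adj E i j) := by
  change ((E >>> (32 * i)) % 2 ^ 32).testBit j = _
  rw [Nat.testBit_mod_two_pow, Nat.testBit_shiftRight, adj_eq_testBit]

theorem adj_link {a b i j : ℕ} (ha : a < 32) (hb : b < 32) (hj : j < 32) :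
    adj (link E a b) i j = true ↔ adj E i j = true ∨ i = a ∧ j = b ∨ i = b ∧ j = a := by
  have : link E a b = E ||| (2 ^ (32 * a + b) ||| 2 ^ (32 * b + a)) := rfl
  rw [adj_eq_testBit, adj_eq_testBit, this]
  simp only [Nat.testBit_or, Nat.testBit_two_pow, Bool.or_eq_true, decide_eq_true_eq]
  have h1 : 32 * a + b = 32 * i + j ↔ i = a ∧ j = b := by omega
  have h2 : 32 * b + a = 32 * i + j ↔ i = b ∧ j = a := by omega
  rw [h1, h2]

theorem atMost_eq_true (k : ℕ) : ∀ (x : ℕ) (S : Finset ℕ), (∀ j, x.testBit j = true → j ∈ S) →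
    S.card ≤ k → atMost k x = true := by
  induction k with
  | zero =>
    intro x S hS hk
    have : x = 0 := Nat.eq_of_testBit_eq fun i => by
      rw [Nat.zero_testBit, Bool.eq_false_iff]
      intro h
      have := hS i h
      simp_all
    subst this
    rfl
  | succ k ih =>
    intro x S hS hk
    change force (x &&& (x - 1)) (atMost k) = true
    rw [force_eq]
    by_cases hx : x = 0
    · subst hx
      exact ih _ ∅ (by simp) (by simp)
    -- Since `x &&& (x - 1)` is smaller than `x`, some digit of `x` is lost; which one does not
    -- matter.
    · obtain ⟨j, hj, hj'⟩ : ∃ j, x.testBit j = true ∧ (x &&& (x - 1)).testBit j = false := by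
        by_contra! hcon
        have h : x &&& (x - 1) = x := Nat.eq_of_testBit_eq fun i => by
          rcases hi : x.testBit i
          · simp [hi]
          · simpa using hcon i hi
        have := @Nat.and_le_right x (x - 1)
        omega
      refine ih _ (S.erase j) (fun i hi => Finset.mem_erase.2 ⟨?_, hS i ?_⟩) ?_
      · rintro rfl
        simp_all
      · rw [Nat.testBit_and, Bool.and_eq_true] at hi
        exact hi.1
      · rw [Finset.card_erase_of_mem (hS j hj)]
        omega

/-- The pattern `P` extends the tuple `q`: each list in `P` asks for a new vertex, adjacent to the
entries of the tuple built so far that it names. -/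
def Fits (H : SimpleGraph V) : List (List ℕ) → List V → Prop
  | [], _ => True
  | r :: P, q => ∃ y, y ∉ q ∧ (∀ i ∈ r, ∃ x, q[i]? = some x ∧ H.Adj x y) ∧ Fits H P (q ++ [y])

/-- Degrees are at most four, and at most three on `T`; there is no complete graph on four
vertices, no `K_{1,1,3}` and no `K_{3,3}`; two nonadjacent vertices of `T` complete one of the
`patterns`. -/
structure IsSaturated (H : SimpleGraph V) (T : Set V) : Prop where
  degree_le : ∀ v (s : Finset V), (∀ x ∈ s, H.Adj v x) → s.card ≤ 4
  degree_le_of_mem : ∀ v ∈ T, ∀ s : Finset V, (∀ x ∈ s, H.Adj v x) → s.card ≤ 3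
  codegree_le : ∀ x y, H.Adj x y → ∀ s : Finset V, (∀ z ∈ s, H.Adj x z ∧ H.Adj y z) → s.card ≤ 2
  not_adj : ∀ x y a b, H.Adj x y → H.Adj x a → H.Adj y a → H.Adj x b → H.Adj y b → ¬ H.Adj a b
  common_le : ∀ x y z, x ≠ y → x ≠ z → y ≠ z → ∀ s : Finset V,
    (∀ w ∈ s, H.Adj x w ∧ H.Adj y w ∧ H.Adj z w) → s.card ≤ 2
  exists_fits : ∀ u ∈ T, ∀ v ∈ T, u ≠ v → ¬ H.Adj u v → ∃ P ∈ patterns, Fits H P [u, v]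

/-- The vertices `f 0, …, f (m - 1)` of `H` are distinct, the first `t` of them lie in `T`, all
pairs in `E` are edges of `H`, and no pair in `N` is. -/
structure Realizes (H : SimpleGraph V) (T : Set V) (t m E N : ℕ) (f : ℕ → V) : Prop where
  inj : ∀ i < m, ∀ j < m, f i = f j → i = j
  mem : ∀ i < t, f i ∈ T
  le : t ≤ m
  edge : ∀ i < 32, ∀ j < 32, adj E i j = true → i < m ∧ j < m ∧ H.Adj (f i) (f j)
  nonedge : ∀ i < 32, ∀ j < 32, adj N i j = true → i < t ∧ j < t ∧ ¬ H.Adj (f i) (f j)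

namespace Realizes

theorem link (h : Realizes H T t m E N f) (hm : m ≤ 32) {a b : ℕ} (ha : a < m) (hb : b < m)
    (hab : H.Adj (f a) (f b)) : Realizes H T t m (link E a b) N f where
  inj := h.inj
  mem := h.mem
  le := h.le
  nonedge := h.nonedge
  edge i hi j hj hij := by
    rcases (adj_link (by omega) (by omega) hj).1 hij with h' | ⟨rfl, rfl⟩ | ⟨rfl, rfl⟩
    · exact h.edge i hi j hj h'
    · exact ⟨ha, hb, hab⟩
    · exact ⟨hb, ha, hab.symm⟩

theorem link_nonedge (h : Realizes H T t m E N f) (hm : m ≤ 32) {a b : ℕ} (ha : a < t)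
    (hb : b < t) (hab : ¬ H.Adj (f a) (f b)) : Realizes H T t m E (Search.link N a b) f where
  inj := h.inj
  mem := h.mem
  le := h.le
  edge := h.edge
  nonedge i hi j hj hij := by
    have := h.le
    rcases (adj_link (by omega) (by omega) hj).1 hij with h' | ⟨rfl, rfl⟩ | ⟨rfl, rfl⟩
    · exact h.nonedge i hi j hj h'
    · exact ⟨ha, hb, hab⟩
    · exact ⟨hb, ha, fun h => hab h.symm⟩

theorem update (h : Realizes H T t m E N f) {y : V} (hy : ∀ i < m, f i ≠ y) :
    Realizes H T t (m + 1) E N (Function.update f m y) := by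
  have hf : ∀ i < m, Function.update f m y i = f i := fun i hi =>
    Function.update_of_ne (by omega) _ _
  have hfm : Function.update f m y m = y := Function.update_self _ _ _
  have hle := h.le
  refine ⟨fun i hi j hj hij => ?_, fun i hi => ?_, by omega, fun i hi j hj hij => ?_,
    fun i hi j hj hij => ?_⟩
  · rcases Nat.lt_succ_iff_lt_or_eq.1 hi with hi | rfl <;>
      rcases Nat.lt_succ_iff_lt_or_eq.1 hj with hj | rfl
    · rw [hf i hi, hf j hj] at hij
      exact h.inj i hi j hj hij
    · rw [hf i hi, hfm] at hij
      exact absurd hij (hy i hi)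
    · rw [hf j hj, hfm] at hij
      exact absurd hij.symm (hy j hj)
    · rfl
  · rw [hf i (by omega)]
    exact h.mem i hi
  · obtain ⟨h1, h2, h3⟩ := h.edge i hi j hj hij
    rw [hf i h1, hf j h2]
    exact ⟨by omega, by omega, h3⟩
  · obtain ⟨h1, h2, h3⟩ := h.nonedge i hi j hj hij
    rw [hf i (by omega), hf j (by omega)]
    exact ⟨h1, h2, h3⟩

theorem of_testBit_row (h : Realizes H T t m E N f) {i j : ℕ} (hi : i < 32)
    (hj : (row E i).testBit j = true) : j < m ∧ H.Adj (f i) (f j) := by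
  rw [testBit_row, Bool.and_eq_true, decide_eq_true_eq] at hj
  exact (h.edge i hi j hj.1 hj.2).2

theorem atMost_eq_true (h : Realizes H T t m E N f) {R : V → Prop} {k x : ℕ}
    (hx : ∀ j, x.testBit j = true → j < m ∧ R (f j))
    (hk : ∀ s : Finset V, (∀ v ∈ s, R v) → s.card ≤ k) : atMost k x = true := by
  classical
  refine Search.atMost_eq_true k x {j ∈ Finset.range m | x.testBit j = true}
    (fun j hj => by simp [hj, (hx j hj).1]) ?_
  rw [← Finset.card_image_of_injOn (f := f)]
  · refine hk _ fun v hv => ?_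
    simp only [Finset.mem_image, Finset.mem_filter] at hv
    obtain ⟨j, ⟨-, hj⟩, rfl⟩ := hv
    exact (hx j hj).2
  · intro i hi j hj hij
    simp only [Finset.coe_filter, Finset.mem_range, Set.mem_ofPred_eq] at hi hj
    exact h.inj i hi.1 j hj.1 hij

theorem card_le_cap (hH : IsSaturated H T) (h : Realizes H T t m E N f) (i : ℕ) (s : Finset V)
    (hs : ∀ v ∈ s, H.Adj (f i) v) : s.card ≤ cap t i := by
  rw [cap]
  cases hb : i.succ.ble t
  · exact hH.degree_le _ s hs
  · exact hH.degree_le_of_mem _ (h.mem i (Nat.le_of_ble_eq_true hb)) s hs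

theorem atMost_cap (hH : IsSaturated H T) (h : Realizes H T t m E N f) {i : ℕ} (hi : i < 32) :
    atMost (cap t i) (row E i) = true :=
  h.atMost_eq_true (fun _ => h.of_testBit_row hi) (card_le_cap hH h i)

/-- A vertex whose recorded neighbours exhaust its degree has no further neighbours. -/
theorem testBit_row_of_not_atMost (hH : IsSaturated H T) (h : Realizes H T t m E N f)
    (hm : m ≤ 32) {i w : ℕ} (hi : i < m) (hE : atMost (cap t i).pred (row E i) = false) {y : V}
    (hy : H.Adj (f i) y) (hw : ∀ j < m, f j = y → j = w) : (row E i).testBit w = true := by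
  classical
  by_contra hcon
  refine absurd ?_ (Bool.eq_false_iff.1 hE)
  refine h.atMost_eq_true (R := fun v => H.Adj (f i) v ∧ v ≠ y) (fun j hj => ?_) fun s hs => ?_
  · obtain ⟨h1, h2⟩ := h.of_testBit_row (by omega) hj
    refine ⟨h1, h2, fun h3 => hcon ?_⟩
    rwa [← hw j h1 h3]
  · have := card_le_cap hH h i (insert y s) (by
      intro v hv
      rcases Finset.mem_insert.1 hv with rfl | hv
      · exact hy
      · exact (hs v hv).1)
    rw [Finset.card_insert_of_notMem fun hys => (hs y hys).2 rfl] at this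
    exact Nat.le_pred_of_lt this

/-- Recorded edges are genuine edges of `H`, so any violation found in the record would occur in
`H`. A branch failing the test therefore has no realization. -/
theorem consistent_eq_true (hH : IsSaturated H T) (h : Realizes H T t m E N f) (hm : m ≤ 32) :
    consistent t m E = true := by
  refine allBelow_eq_true _ _ fun i hi => ?_
  simp only [force_eq, h.atMost_cap hH (show i < 32 by omega), cond_true]
  refine allBelow_eq_true _ _ fun j hj => ?_
  set c := Nat.land (row E i) (row E j) with hc
  have hcb : ∀ k, c.testBit k = true →
      (k < m ∧ H.Adj (f i) (f k)) ∧ k < m ∧ H.Adj (f j) (f k) := by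
    intro k hk
    rw [hc, show Nat.land (row E i) (row E j) = row E i &&& row E j from rfl, Nat.testBit_and,
      Bool.and_eq_true] at hk
    exact ⟨h.of_testBit_row (by omega) hk.1, h.of_testBit_row (by omega) hk.2⟩
  rw [pairOk]
  cases c.beq 0
  swap
  · rfl
  rw [cond_false, allBelow_eq_true _ j, cond_true]
  · cases hij : adj E i j
    · rfl
    obtain ⟨-, -, hij⟩ := h.edge i (by omega) j (by omega) hij
    rw [cond_true, h.atMost_eq_true (R := fun v => H.Adj (f i) v ∧ H.Adj (f j) v) (x := c)
      (fun k hk => ⟨(hcb k hk).1.1, (hcb k hk).1.2, (hcb k hk).2.2⟩) (hH.codegree_le _ _ hij),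
      cond_true]
    refine allBelow_eq_true _ _ fun k hk => ?_
    rw [bit_eq_testBit]
    cases hck : c.testBit k
    · rfl
    rw [cond_true, Nat.beq_eq]
    refine Nat.eq_of_testBit_eq fun l => ?_
    rw [Nat.zero_testBit, Bool.eq_false_iff]
    intro hl
    rw [show Nat.land c (row E k) = c &&& row E k from rfl, Nat.testBit_and,
      Bool.and_eq_true] at hl
    exact hH.not_adj _ _ _ _ hij (hcb k hck).1.2 (hcb k hck).2.2 (hcb l hl.1).1.2
      (hcb l hl.1).2.2 (h.of_testBit_row (by omega) hl.2).2
  · intro k hk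
    have hne : ∀ a < m, ∀ b < m, a ≠ b → f a ≠ f b := fun a ha b hb hab hf =>
      hab (h.inj a ha b hb hf)
    refine h.atMost_eq_true (R := fun v => H.Adj (f i) v ∧ H.Adj (f j) v ∧ H.Adj (f k) v)
      (fun l hl => ?_) (hH.common_le _ _ _ (hne _ (by omega) _ (by omega) (by omega))
        (hne _ (by omega) _ (by omega) (by omega)) (hne _ (by omega) _ (by omega) (by omega)))
    rw [show Nat.land c (row E k) = c &&& row E k from rfl, Nat.testBit_and,
      Bool.and_eq_true] at hl
    exact ⟨(hcb l hl.1).1.1, (hcb l hl.1).1.2, (hcb l hl.1).2.2,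
      (h.of_testBit_row (by omega) hl.2).2⟩

end Realizes

end SimpleGraph.Search

/-! ### Soundness of the search -/

namespace SimpleGraph.Search

variable {V : Type*} {H : SimpleGraph V} {T : Set V} {t m E N : ℕ} {f : ℕ → V}

theorem getD_of_getElem?_map {p : List ℕ} {i : ℕ} {x : V} (h : (p.map f)[i]? = some x) :
    p.getD i 0 ∈ p ∧ f (p.getD i 0) = x := by
  rw [List.getElem?_map, Option.map_eq_some_iff] at h
  obtain ⟨a, ha, rfl⟩ := h
  rw [List.getD_eq_getElem?_getD, ha]
  exact ⟨List.mem_of_getElem? ha, rfl⟩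

theorem Realizes.foldr_link (h : Realizes H T t m E N f) (hm : m ≤ 32) {w : ℕ} (hw : w < m)
    (p r : List ℕ) (hr : ∀ i ∈ r, p.getD i 0 < m ∧ H.Adj (f (p.getD i 0)) (f w)) :
    Realizes H T t m (r.foldr (fun i E => Search.link E (p.getD i 0) w) E) N f := by
  induction r with
  | nil => exact h
  | cons i r ih =>
    exact (ih fun j hj => hr j (List.mem_cons_of_mem _ hj)).link hm
      (hr i List.mem_cons_self).1 hw (hr i List.mem_cons_self).2

/-- The mask keeps the index of the vertex sought: only rows of vertices with exhausted degree are
intersected, and those rows already contain every neighbour. -/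
theorem Realizes.testBit_foldr (hH : IsSaturated H T) (h : Realizes H T t m E N f) (hm : m < 32)
    {w : ℕ} (hw : w ≤ m) {y : V} (hwy : ∀ j < m, f j = y → j = w) (p r : List ℕ)
    (hr : ∀ i ∈ r, p.getD i 0 < m ∧ H.Adj (f (p.getD i 0)) y) :
    (r.foldr (fun i a => cond (atMost (cap t (p.getD i 0)).pred (row E (p.getD i 0))) a
      (Nat.land a (row E (p.getD i 0)))) 4294967295).testBit w = true := by
  induction r with
  | nil =>
    change (2 ^ 32 - 1).testBit w = true
    rw [Nat.testBit_two_pow_sub_one, decide_eq_true_eq]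
    omega
  | cons i r ih =>
    have ih := ih fun j hj => hr j (List.mem_cons_of_mem _ hj)
    obtain ⟨h1, h2⟩ := hr i List.mem_cons_self
    rw [List.foldr_cons]
    cases hc : atMost (cap t (p.getD i 0)).pred (row E (p.getD i 0))
    · rw [cond_false, show ∀ a b : ℕ, Nat.land a b = a &&& b from fun _ _ => rfl,
        Nat.testBit_and, ih, h.testBit_row_of_not_atMost hH hm.le h1 hc h2 hwy]
      rfl
    · exact ih

theorem mem_collect {α : Type} (g : ℕ → List α → List α) (hg : ∀ w l, ∀ x ∈ l, x ∈ g w l)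
    {x : α} {w : ℕ} (hw : ∀ l, x ∈ g w l) (n : ℕ) (hn : w < n) :
    x ∈ collect g n := by
  induction n with
  | zero => omega
  | succ n ih =>
    rcases Nat.lt_succ_iff_lt_or_eq.1 hn with h | rfl
    · exact hg _ _ _ (ih h)
    · exact hw _

/-- An actual occurrence of the pattern in `H` is followed through the enumeration: each of its
vertices selects a branch that no test discards. -/
theorem exists_mem_extend (hH : IsSaturated H T) (P : List (List ℕ)) :
    ∀ {m E : ℕ} {f : ℕ → V} {p : List ℕ}, Realizes H T t m E N f → m + P.length ≤ 32 →
      (∀ a ∈ p, a < m) → Fits H P (p.map f) →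
      ∃ m' E' f', (m', E') ∈ extend t N P m E p ∧ m' ≤ m + P.length ∧
        Realizes H T t m' E' N f' := by
  induction P with
  | nil =>
    intro m E f p h hm hp _
    refine ⟨m, E, f, ?_, le_rfl, h⟩
    change (m, E) ∈ cond (consistent t m E) [(m, E)] []
    rw [h.consistent_eq_true hH hm]
    exact List.mem_cons_self
  | cons r P ih =>
    rintro m E f p h hm hp ⟨y, hy, hr, hP⟩
    rw [List.length_cons] at hm
    have hr' : ∀ i ∈ r, p.getD i 0 ∈ p ∧ H.Adj (f (p.getD i 0)) y := by
      intro i hi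
      obtain ⟨x, hx, hxy⟩ := hr i hi
      obtain ⟨h1, h2⟩ := getD_of_getElem?_map hx
      exact ⟨h1, h2.symm ▸ hxy⟩
    -- Either `y` is present already, with index `w < m`, or it is new and receives the index `m`.
    obtain ⟨w, f₁, hw, hwy, hf₁, hfw, h₁⟩ : ∃ w f₁, w ≤ m ∧ (∀ j < m, f j = y → j = w) ∧
        (∀ j < m, f₁ j = f j) ∧ f₁ w = y ∧
        Realizes H T t (cond (w.beq m) m.succ m) E N f₁ := by
      by_cases hyf : ∃ w < m, f w = y
      · obtain ⟨w, hw, rfl⟩ := hyf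
        refine ⟨w, f, hw.le, fun j hj hjw => h.inj j hj w hw hjw, fun _ _ => rfl, rfl, ?_⟩
        cases hb : w.beq m
        · exact h
        · have := Nat.eq_of_beq_eq_true hb
          omega
      · push Not at hyf
        refine ⟨m, Function.update f m y, le_rfl, fun j hj hjy => absurd hjy (hyf j hj),
          fun j hj => Function.update_of_ne (by omega) _ _, Function.update_self _ _ _, ?_⟩
        cases hb : m.beq m
        · exact absurd rfl (Nat.ne_of_beq_eq_false hb)
        · exact h.update hyf
    have hm₁ : w < cond (w.beq m) m.succ m ∧ m ≤ cond (w.beq m) m.succ m ∧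
        cond (w.beq m) m.succ m ≤ m + 1 := by
      cases hb : w.beq m
      · have := Nat.ne_of_beq_eq_false hb
        exact ⟨show w < m by omega, le_refl m, Nat.le_succ m⟩
      · exact ⟨Nat.lt_succ_of_le hw, Nat.le_succ m, le_refl (m + 1)⟩
    obtain ⟨hw₁, hm₁, hm₂⟩ := hm₁
    have h₂ := h₁.foldr_link (by omega) hw₁ p r fun i hi =>
      ⟨(hp _ (hr' i hi).1).trans_le hm₁, by
        rw [hf₁ _ (hp _ (hr' i hi).1), hfw]
        exact (hr' i hi).2⟩
    have hpm : (p ++ [w]).map f₁ = p.map f ++ [y] := by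
      rw [List.map_append, List.map_singleton, hfw]
      congr 1
      exact List.map_congr_left fun a ha => hf₁ a (hp a ha)
    obtain ⟨m', E', f', hmem, hm', h'⟩ := ih h₂ (by omega) (p := p ++ [w]) (by
      intro a ha
      rcases List.mem_append.1 ha with ha | ha
      · exact (hp a ha).trans_le hm₁
      · rw [List.mem_singleton.1 ha]
        exact hw₁) (hpm ▸ hP)
    refine ⟨m', E', f', ?_, by rw [List.length_cons]; omega, h'⟩
    rw [extend] at hmem ⊢
    dsimp only
    rw [force_eq]
    refine mem_collect _ (fun w l x hx => ?_) (w := w) (fun l => ?_) _ (by omega)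
    · simp only [force_eq]
      cases bit _ w
      · exact hx
      cases p.any w.beq
      swap
      · exact hx
      cases r.any _
      swap
      · exact hx
      cases atMost _ _
      · exact hx
      · exact List.mem_append_right _ hx
    · have hwp : p.any w.beq = false := by
        rw [List.any_eq_false]
        intro a ha hwa
        obtain rfl := Nat.eq_of_beq_eq_true hwa
        exact hy (List.mem_map.2 ⟨w, ha, by rw [← hf₁ w (hp w ha), hfw]⟩)
      have hN : (r.any fun i => adj N (p.getD i 0) w) = false := by
        rw [List.any_eq_false]
        intro i hi hiw
        have hpi := hp _ (hr' i hi).1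
        refine (h₁.nonedge _ (by omega) w (by omega) hiw).2.2 ?_
        rw [hf₁ _ hpi, hfw]
        exact (hr' i hi).2
      simp only [force_eq] at hmem ⊢
      rw [bit_eq_testBit, h.testBit_foldr hH (by omega) hw hwy p r fun i hi =>
        ⟨hp _ (hr' i hi).1, (hr' i hi).2⟩, hwp, hN, h₂.atMost_cap hH (show w < 32 by omega)]
      exact List.mem_append_left _ hmem

theorem mem_nub {a : ℕ × ℕ} {l : List (ℕ × ℕ)} (h : a ∈ l) : a ∈ nub l := by
  induction l with
  | nil => exact h
  | cons b l ih =>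
    rw [nub]
    cases hb : l.any fun c => cond (b.2.beq c.2) (b.1.beq c.1) false
    · rcases List.mem_cons.1 h with rfl | h
      · exact List.mem_cons_self
      · exact List.mem_cons_of_mem _ (ih h)
    · rcases List.mem_cons.1 h with rfl | h
      · obtain ⟨c, hc, hac⟩ := List.any_eq_true.1 hb
        cases h2 : a.2.beq c.2
        · rw [h2] at hac
          cases hac
        · rw [h2, cond_true] at hac
          obtain rfl := Prod.ext (Nat.eq_of_beq_eq_true hac) (Nat.eq_of_beq_eq_true h2)
          exact ih hc
      · exact ih h

theorem exists_mem_options (hH : IsSaturated H T) (h : Realizes H T t m E N f) (hm : m ≤ 28)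
    {u v : ℕ} (hu : u < t) (hv : v < t) (huv : u ≠ v) (hadj : ¬ H.Adj (f u) (f v)) :
    ∃ a ∈ options t N m E u v, ∃ f', Realizes H T t a.1 a.2 N f' := by
  have hle := h.le
  obtain ⟨P, hP, hfit⟩ := hH.exists_fits _ (h.mem u hu) _ (h.mem v hv)
    (fun huv' => huv (h.inj u (by omega) v (by omega) huv')) hadj
  have hlen : ∀ P ∈ patterns, P.length ≤ 4 := by decide
  obtain ⟨m', E', f', hmem, -, h'⟩ := exists_mem_extend hH P h (by have := hlen P hP; omega)
    (p := [u, v]) (by simp; omega) hfit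
  exact ⟨(m', E'), mem_nub (List.mem_flatMap.2 ⟨P, hP, hmem⟩), f', h'⟩

/-- A realization survives in some branch: `f u` and `f v` are adjacent in `H`, or saturation
completes a pattern that `options` lists. -/
theorem refute_sound (hH : IsSaturated H T) (l : List (ℕ × ℕ))
    (hl : ∀ a ∈ l, a.1 < t ∧ a.2 < t ∧ a.1 ≠ a.2) :
    ∀ {m E N : ℕ} {f : ℕ → V}, refute t l m E N = true → ¬ Realizes H T t m E N f := by
  induction l with
  | nil => intro m E N f h; cases h
  | cons a l ih =>
    obtain ⟨u, v⟩ := a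
    obtain ⟨hu, hv, huv⟩ : u < t ∧ v < t ∧ u ≠ v := hl _ List.mem_cons_self
    have ih := @ih fun a ha => hl a (List.mem_cons_of_mem _ ha)
    intro m E N f hr h
    have hle := h.le
    rw [refute] at hr
    cases hm : m.ble 28
    · rw [hm] at hr
      cases hr
    have hm' := Nat.le_of_ble_eq_true hm
    rw [hm, cond_true] at hr
    cases hE : adj E u v
    swap
    · rw [hE, cond_true] at hr
      exact ih hr h
    simp only [hE, cond_false, force_eq] at hr
    cases hc : cond (adj N u v) true
        (cond (consistent t m (link E u v)) (refute t l m (link E u v) N) true)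
    · rw [hc] at hr
      cases hr
    rw [hc, cond_true] at hr
    by_cases hadj : H.Adj (f u) (f v)
    · have h' := h.link (by omega) (by omega) (by omega) hadj
      cases hN : adj N u v
      · rw [hN, h'.consistent_eq_true hH (by omega), cond_false, cond_true] at hc
        exact ih hc h'
      · exact (h.nonedge u (by omega) v (by omega) hN).2.2 hadj
    · have h' := h.link_nonedge (by omega) hu hv hadj
      cases hs : (options t (link N u v) m E u v).any fun a => a.2.beq E
      · rw [hs, cond_false, List.all_eq_true] at hr
        obtain ⟨a, ha, f', ha'⟩ := exists_mem_options hH h' hm' hu hv huv hadj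
        exact ih (hr a ha) ha'
      · rw [hs, cond_true] at hr
        exact ih hr h'

/-- All six pairs are decided, so only the three nonedges have consequences to explore. -/
theorem refute_path :
    refute 4 [(0, 2), (0, 3), (1, 3)] 4 (link (link (link 0 0 1) 1 2) 2 3)
      (link (link (link 0 0 2) 1 3) 0 3) = true := by
  decide +kernel

/-- A triangle alone has no nonadjacent pair to which saturation applies; the two further vertices
of `T` supply the pairs to branch on. -/
theorem refute_triangle :
    refute 5 [(0, 3), (1, 3), (2, 3), (0, 4), (1, 4), (2, 4), (3, 4)] 5
      (link (link (link 0 0 1) 1 2) 0 2) 0 = true := by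
  decide +kernel

/-- The three known nonedges remain in the list because each must still complete a pattern. -/
theorem refute_independent :
    refute 5 [(0, 1), (0, 2), (1, 2), (0, 3), (1, 3), (2, 3), (0, 4), (1, 4), (2, 4), (3, 4)] 5
      0 (link (link (link 0 0 1) 1 2) 0 2) = true := by
  decide +kernel

end SimpleGraph.Search

/-! ### Matchings on six vertices and the subgraphs they forbid in the complement -/

namespace SimpleGraph

variable {V : Type*} {G : SimpleGraph V}

/-- `G` has a matching covering exactly the vertices of `W`. -/
def HasMatchingOn (G : SimpleGraph V) (W : Set V) : Prop :=
  ∃ σ : V → V, ∀ w ∈ W, σ w ∈ W ∧ G.Adj w (σ w) ∧ σ (σ w) = w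

theorem exists_isPerfectMatching_induce_iff (G : SimpleGraph V) (W : Set V) :
    (∃ M : (G.induce W).Subgraph, M.IsPerfectMatching) ↔ G.HasMatchingOn W := by
  classical
  constructor
  · rintro ⟨M, hM, hspan⟩
    choose g hg using fun w : W => (hM (hspan w)).exists
    have huniq : ∀ a b : W, M.Adj a b → g a = b := fun a b hab =>
      (hM (hspan a)).unique (hg a) hab
    refine ⟨fun w => if h : w ∈ W then g ⟨w, h⟩ else w, fun w hw => ?_⟩
    have hgw := (g ⟨w, hw⟩).2
    refine ⟨by simp [hw], ?_, ?_⟩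
    · simpa [hw] using (hg ⟨w, hw⟩).adj_sub
    · simp only [hw, dif_pos, hgw, Subtype.coe_eta]
      rw [huniq _ _ (hg ⟨w, hw⟩).symm]
  · rintro ⟨σ, hσ⟩
    refine ⟨{ verts := Set.univ
              Adj := fun a b => σ a = b
              adj_sub := ?_
              edge_vert := fun _ => Set.mem_univ _
              symm := ⟨?_⟩ }, ?_, fun _ => Set.mem_univ _⟩
    · rintro a b hab
      simpa [← hab] using (hσ a a.2).2.1
    · rintro a b hab
      rw [← hab]
      exact (hσ a a.2).2.2
    · intro a _
      exact ⟨⟨σ a, (hσ a a.2).1⟩, rfl, fun b hb => Subtype.ext (Eq.symm hb)⟩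

theorem isFactorCritical_card_sub_iff [Fintype V] (G : SimpleGraph V) {k : ℕ}
    (hk : 0 < k) (hV : k < Fintype.card V) :
    G.IsFactorCritical (Fintype.card V - k) ↔ ∀ W : Finset V, W.card = k → G.HasMatchingOn W := by
  classical
  simp only [IsFactorCritical, exists_isPerfectMatching_induce_iff]
  constructor
  · rintro ⟨-, -, h⟩ W hW
    have := h Wᶜ (by rw [Finset.card_compl, hW])
    rwa [Finset.coe_compl, compl_compl] at this
  · intro h
    refine ⟨by omega, by omega, fun S hS => ?_⟩
    have := h Sᶜ (by rw [Finset.card_compl, hS]; omega)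
    rwa [Finset.coe_compl] at this

theorem hasMatchingOn_six {a b c d e f : V} (h : [a, b, c, d, e, f].Nodup) (hab : G.Adj a b)
    (hcd : G.Adj c d) (hef : G.Adj e f) : G.HasMatchingOn {a, b, c, d, e, f} := by
  classical
  simp only [List.nodup_cons, List.mem_cons, List.not_mem_nil, or_false, not_or] at h
  refine ⟨fun w => if w = a then b else if w = b then a else if w = c then d else
    if w = d then c else if w = e then f else e, ?_⟩
  have := hab.symm
  have := hcd.symm
  have := hef.symm
  simp only [Set.mem_insert_iff, Set.mem_singleton_iff]
  rintro w (rfl | rfl | rfl | rfl | rfl | rfl) <;> grind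

section Forbidden

variable (hG : ∀ W : Finset V, W.card = 6 → G.HasMatchingOn W)
include hG

/-- Excludes `K_{1,5}`: its centre would be isolated in `G` among six vertices. -/
theorem card_le_four_of_compl_adj (v : V) (s : Finset V) (hs : ∀ x ∈ s, Gᶜ.Adj v x) :
    s.card ≤ 4 := by
  classical
  by_contra! hcard
  obtain ⟨t, hts, ht⟩ := Finset.exists_subset_card_eq hcard
  have hvt : v ∉ t := fun h => (hs v (hts h)).ne rfl
  obtain ⟨σ, hσ⟩ := hG (insert v t) (by rw [Finset.card_insert_of_notMem hvt, ht])
  obtain ⟨h1, h2, -⟩ := hσ v (by simp)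
  rcases Finset.mem_insert.1 h1 with h1 | h1
  · exact h2.ne h1.symm
  · exact (hs _ (hts h1)).2 h2

/-- Excludes `K_{1,1,3}`: after adding a sixth vertex `e`, both `x` and `y` could be matched only to
`e`. -/
theorem card_le_two_of_compl_adj [Fintype V] (hV : 6 ≤ Fintype.card V) {x y : V}
    (hxy : Gᶜ.Adj x y) (s : Finset V) (hs : ∀ z ∈ s, Gᶜ.Adj x z ∧ Gᶜ.Adj y z) : s.card ≤ 2 := by
  classical
  by_contra! hcard
  obtain ⟨t, hts, ht⟩ := Finset.exists_subset_card_eq hcard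
  have hs : ∀ z ∈ t, Gᶜ.Adj x z ∧ Gᶜ.Adj y z := fun z hz => hs z (hts hz)
  have hyt : y ∉ t := fun h => (hs y h).2.ne rfl
  have hxt : x ∉ insert y t := by
    rw [Finset.mem_insert]
    rintro (h | h)
    · exact hxy.ne h
    · exact (hs x h).1.ne rfl
  obtain ⟨e, he⟩ : ∃ e, e ∉ insert x (insert y t) := by
    by_contra! h
    have := Finset.card_le_card fun z (_ : z ∈ Finset.univ) => h z
    rw [Finset.card_insert_of_notMem hxt, Finset.card_insert_of_notMem hyt, ht,
      Finset.card_univ] at this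
    omega
  obtain ⟨σ, hσ⟩ := hG (insert e (insert x (insert y t))) (by
    rw [Finset.card_insert_of_notMem he, Finset.card_insert_of_notMem hxt,
      Finset.card_insert_of_notMem hyt, ht])
  have hx := hσ x (by simp)
  have hy := hσ y (by simp)
  have hxe : σ x = e := by
    have := hx.1
    have h2 := hx.2.1
    simp only [Finset.coe_insert, Set.mem_insert_iff, Finset.mem_coe] at this
    rcases this with h | h | h | h
    · exact h
    · exact absurd h.symm h2.ne
    · rw [h] at h2
      exact absurd h2 hxy.2
    · exact absurd h2 (hs _ h).1.2
  have hye : σ y = e := by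
    have := hy.1
    have h2 := hy.2.1
    simp only [Finset.coe_insert, Set.mem_insert_iff, Finset.mem_coe] at this
    rcases this with h | h | h | h
    · exact h
    · rw [h] at h2
      exact absurd h2.symm hxy.2
    · exact absurd h.symm h2.ne
    · exact absurd h2 (hs _ h).2.2
  exact hxy.ne (by rw [← hx.2.2, ← hy.2.2, hxe, hye])

/-- Excludes `K_4`: in a six-set containing it, already three of its vertices would compete for the
two vertices outside it. -/
theorem not_compl_adj_of_triangles [Fintype V] (hV : 6 ≤ Fintype.card V) {x y a b : V}
    (hxy : Gᶜ.Adj x y) (hxa : Gᶜ.Adj x a) (hya : Gᶜ.Adj y a) (hxb : Gᶜ.Adj x b)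
    (hyb : Gᶜ.Adj y b) : ¬ Gᶜ.Adj a b := by
  classical
  intro hab
  have hcard : ({x, y, a, b} : Finset V).card = 4 :=
    Finset.card_eq_of_equiv_fin (n := 4) (by
      refine (Finset.equivFinOfCardEq ?_)
      rw [Finset.card_insert_of_notMem, Finset.card_insert_of_notMem, Finset.card_pair hab.ne]
      · simp [hya.ne, hyb.ne]
      · simp [hxy.ne, hxa.ne, hxb.ne])
  obtain ⟨W, hW, hWcard⟩ := Finset.exists_superset_card_eq (s := {x, y, a, b}) (n := 6)
    (by omega) hV
  obtain ⟨σ, hσ⟩ := hG W hWcard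
  have hrest : (W \ {x, y, a, b}).card = 2 := by
    rw [Finset.card_sdiff_of_subset hW]
    omega
  obtain ⟨e, f, -, hef⟩ := Finset.card_eq_two.1 hrest
  have hmem : ∀ z ∈ W, z = x ∨ z = y ∨ z = a ∨ z = b ∨ z = e ∨ z = f := by
    intro z hz
    by_cases hz' : z ∈ ({x, y, a, b} : Finset V)
    · simp only [Finset.mem_insert, Finset.mem_singleton] at hz'
      tauto
    · have : z ∈ W \ {x, y, a, b} := Finset.mem_sdiff.2 ⟨hz, hz'⟩
      rw [hef] at this
      simp only [Finset.mem_insert, Finset.mem_singleton] at this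
      tauto
  have hx := hσ x (hW (by simp))
  have hy := hσ y (hW (by simp))
  have ha := hσ a (hW (by simp))
  have hef : ∀ z ∈ W, (∀ w ∈ ({x, y, a, b} : Finset V), ¬ G.Adj z w) → σ z = e ∨ σ z = f := by
    intro z hz hzw
    rcases hmem _ (hσ z hz).1 with h | h | h | h | h | h
    iterate 4 exact absurd (hσ z hz).2.1 (hzw _ (by simp [h]))
    · exact Or.inl h
    · exact Or.inr h
  have hadj : ∀ {z w}, Gᶜ.Adj z w → ¬ G.Adj z w ∧ ¬ G.Adj w z := fun h =>
    ⟨h.2, fun h' => h.2 h'.symm⟩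
  have hx' := hef x (hW (by simp)) (by simp [hadj hxy, hadj hxa, hadj hxb])
  have hy' := hef y (hW (by simp)) (by simp [hadj hxy, hadj hya, hadj hyb])
  have ha' := hef a (hW (by simp)) (by simp [hadj hxa, hadj hya, hadj hab])
  have hx := hx.2.2
  have hy := hy.2.2
  have ha := ha.2.2
  have hxy := hxy.ne
  have hxa := hxa.ne
  have hya := hya.ne
  rcases hx' with h1 | h1 <;> rcases hy' with h2 | h2 <;> rcases ha' with h3 | h3 <;>
    simp_all

/-- Excludes `K_{3,3}`: each part could be matched only within itself, but has odd size. -/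
theorem card_le_two_of_compl_adj_three {x y z : V} (hxy : x ≠ y) (hxz : x ≠ z) (hyz : y ≠ z)
    (s : Finset V) (hs : ∀ w ∈ s, Gᶜ.Adj x w ∧ Gᶜ.Adj y w ∧ Gᶜ.Adj z w) : s.card ≤ 2 := by
  classical
  by_contra! hcard
  obtain ⟨t, hts, ht⟩ := Finset.exists_subset_card_eq hcard
  have hs : ∀ w ∈ t, Gᶜ.Adj x w ∧ Gᶜ.Adj y w ∧ Gᶜ.Adj z w := fun w hw => hs w (hts hw)
  have hzt : z ∉ t := fun h => (hs z h).2.2.ne rfl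
  have hyt : y ∉ insert z t := by
    rw [Finset.mem_insert]
    exact fun h => h.elim hyz fun h => (hs y h).2.1.ne rfl
  have hxt : x ∉ insert y (insert z t) := by
    rw [Finset.mem_insert, Finset.mem_insert]
    exact fun h => h.elim hxy fun h => h.elim hxz fun h => (hs x h).1.ne rfl
  obtain ⟨σ, hσ⟩ := hG (insert x (insert y (insert z t))) (by
    rw [Finset.card_insert_of_notMem hxt, Finset.card_insert_of_notMem hyt,
      Finset.card_insert_of_notMem hzt, ht])
  have hx := hσ x (by simp)
  have hy := hσ y (by simp)
  have hz := hσ z (by simp)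
  simp only [Finset.coe_insert, Set.mem_insert_iff, Finset.mem_coe, compl_adj] at hx hy hz hs
  have := fun z => G.irrefl (v := z)
  grind

end Forbidden

/-! ### What joining two vertices of the complement creates -/

namespace Search

variable {H : SimpleGraph V} {u v x y z w : V}

/-- `K_4` without the edge `uv`. -/
theorem exists_fits_of_common_adj (hux : H.Adj u x) (hvx : H.Adj v x) (huy : H.Adj u y)
    (hvy : H.Adj v y) (hxy : H.Adj x y) : ∃ P ∈ patterns, Fits H P [u, v] := by
  refine ⟨[[0, 1], [0, 1, 2]], by decide, x, ?_, ?_, y, ?_, ?_, trivial⟩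
  · simp [hux.ne', hvx.ne']
  · simp [hux, hvx]
  · simp [huy.ne', hvy.ne', hxy.ne']
  · simp [huy, hvy, hxy]

/-- `K_{1,1,3}` without `uv`, where `u` and `v` are the singleton parts. -/
theorem exists_fits_of_three_common (hux : H.Adj u x) (hvx : H.Adj v x) (huy : H.Adj u y)
    (hvy : H.Adj v y) (huz : H.Adj u z) (hvz : H.Adj v z) (hxy : x ≠ y) (hxz : x ≠ z)
    (hyz : y ≠ z) : ∃ P ∈ patterns, Fits H P [u, v] := by
  refine ⟨[[0, 1], [0, 1], [0, 1]], by decide, x, ?_, ?_, y, ?_, ?_, z, ?_, ?_, trivial⟩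
  · simp [hux.ne', hvx.ne']
  · simp [hux, hvx]
  · simp [huy.ne', hvy.ne', hxy.symm]
  · simp [huy, hvy]
  · simp [huz.ne', hvz.ne', hxz.symm, hyz.symm]
  · simp [huz, hvz]

/-- `K_{1,1,3}` without `uv`, with singleton parts `u`, `x` and with `v` in the part of size three.
-/
theorem exists_fits_of_spoke (hux : H.Adj u x) (hvx : H.Adj v x) (huy : H.Adj u y)
    (hxy : H.Adj x y) (huz : H.Adj u z) (hxz : H.Adj x z) (hvy : v ≠ y) (hvz : v ≠ z)
    (hyz : y ≠ z) : ∃ P ∈ patterns, Fits H P [u, v] := by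
  refine ⟨[[0, 1], [0, 2], [0, 2]], by decide, x, ?_, ?_, y, ?_, ?_, z, ?_, ?_, trivial⟩
  · simp [hux.ne', hvx.ne']
  · simp [hux, hvx]
  · simp [huy.ne', hvy.symm, hxy.ne']
  · simp [huy, hxy]
  · simp [huz.ne', hvz.symm, hxz.ne', hyz.symm]
  · simp [huz, hxz]

theorem exists_fits_of_spoke' (hux : H.Adj u x) (hvx : H.Adj v x) (hvy : H.Adj v y)
    (hxy : H.Adj x y) (hvz : H.Adj v z) (hxz : H.Adj x z) (huy : u ≠ y) (huz : u ≠ z)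
    (hyz : y ≠ z) : ∃ P ∈ patterns, Fits H P [u, v] := by
  refine ⟨[[0, 1], [1, 2], [1, 2]], by decide, x, ?_, ?_, y, ?_, ?_, z, ?_, ?_, trivial⟩
  · simp [hux.ne', hvx.ne']
  · simp [hux, hvx]
  · simp [hvy.ne', huy.symm, hxy.ne']
  · simp [hvy, hxy]
  · simp [hvz.ne', huz.symm, hxz.ne', hyz.symm]
  · simp [hvz, hxz]

/-- `K_{3,3}` without `uv`, with parts `{u, z, w}` and `{v, x, y}`. -/
theorem exists_fits_of_cross (hux : H.Adj u x) (huy : H.Adj u y) (hvz : H.Adj v z)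
    (hvw : H.Adj v w) (hxz : H.Adj x z) (hxw : H.Adj x w) (hyz : H.Adj y z) (hyw : H.Adj y w)
    (hvx : v ≠ x) (hvy : v ≠ y) (huz : u ≠ z) (huw : u ≠ w) (hxy : x ≠ y) (hzw : z ≠ w) :
    ∃ P ∈ patterns, Fits H P [u, v] := by
  refine ⟨[[0], [0], [1, 2, 3], [1, 2, 3]], by decide, x, ?_, ?_, y, ?_, ?_, z, ?_, ?_, w, ?_, ?_,
    trivial⟩
  · simp [hux.ne', hvx.symm]
  · simp [hux]
  · simp [huy.ne', hvy.symm, hxy.symm]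
  · simp [huy]
  · simp [hvz.ne', huz.symm, hxz.ne', hyz.ne']
  · simp [hvz, hxz, hyz]
  · simp [hvw.ne', huw.symm, hxw.ne', hyw.ne', hzw.symm]
  · simp [hvw, hxw, hyw]

end Search

/-- If `H` has no edge `ab` or `cd`, and its edges meet each of the twelve matchings that extend
neither `uv` nor the pair `ab`, `cd`, then `H` completes a pattern at `u` and `v`. -/
theorem exists_fits_of_forall_or {H : SimpleGraph V} {u v a b c d : V}
    (h : [u, v, a, b, c, d].Nodup) (hab : ¬ H.Adj a b) (hcd : ¬ H.Adj c d)
    (hu : ¬ (H.Adj u a ∧ H.Adj u b ∧ H.Adj u c ∧ H.Adj u d))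
    (hv : ¬ (H.Adj v a ∧ H.Adj v b ∧ H.Adj v c ∧ H.Adj v d))
    (key : ∀ p q r s : V, [p, q, r, s] ⊆ [a, b, c, d] → p ≠ q → p ≠ r → p ≠ s → q ≠ r → q ≠ s →
      r ≠ s → H.Adj u p ∨ H.Adj v q ∨ H.Adj r s) :
    ∃ P ∈ Search.patterns, Search.Fits H P [u, v] := by
  have hnd := h
  simp only [List.nodup_cons, List.mem_cons, List.not_mem_nil, or_false, not_or] at hnd
  obtain ⟨⟨huv, hua, hub, huc, hud⟩, ⟨hva, hvb, hvc, hvd⟩, ⟨nab, nac, nad⟩, ⟨nbc, nbd⟩, ncd, -⟩ :=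
    hnd
  by_contra hno
  have := key a b c d (by simp) nab nac nad nbc nbd ncd
  have := key a c b d (by simp) nac nab nad (Ne.symm nbc) ncd nbd
  have := key a d b c (by simp) nad nab nac (Ne.symm nbd) (Ne.symm ncd) nbc
  have := key b a c d (by simp) (Ne.symm nab) nbc nbd nac nad ncd
  have := key b c a d (by simp) nbc (Ne.symm nab) nbd (Ne.symm nac) ncd nad
  have := key b d a c (by simp) nbd (Ne.symm nab) nbc (Ne.symm nad) (Ne.symm ncd) nac
  have := key c a b d (by simp) (Ne.symm nac) (Ne.symm nbc) ncd nab nad nbd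
  have := key c b a d (by simp) (Ne.symm nbc) (Ne.symm nac) ncd (Ne.symm nab) nbd nad
  have := key c d a b (by simp) ncd (Ne.symm nac) (Ne.symm nbc) (Ne.symm nad) (Ne.symm nbd) nab
  have := key d a b c (by simp) (Ne.symm nad) (Ne.symm nbd) (Ne.symm ncd) nab nac nbc
  have := key d b a c (by simp) (Ne.symm nbd) (Ne.symm nad) (Ne.symm ncd) (Ne.symm nab) nbc nac
  have := key d c a b (by simp) (Ne.symm ncd) (Ne.symm nad) (Ne.symm nbd) (Ne.symm nac) (Ne.symm nbc) nab
  -- All placements of the patterns compatible with `ab` and `cd` being nonedges; what remains is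
  -- propositional.
  have : H.Adj u a → H.Adj v a → H.Adj u c → H.Adj v c → H.Adj a c → False := fun h1 h2 h3 h4 h5 =>
    hno (Search.exists_fits_of_common_adj h1 h2 h3 h4 h5)
  have : H.Adj u a → H.Adj v a → H.Adj u d → H.Adj v d → H.Adj a d → False := fun h1 h2 h3 h4 h5 =>
    hno (Search.exists_fits_of_common_adj h1 h2 h3 h4 h5)
  have : H.Adj u b → H.Adj v b → H.Adj u c → H.Adj v c → H.Adj b c → False := fun h1 h2 h3 h4 h5 =>
    hno (Search.exists_fits_of_common_adj h1 h2 h3 h4 h5)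
  have : H.Adj u b → H.Adj v b → H.Adj u d → H.Adj v d → H.Adj b d → False := fun h1 h2 h3 h4 h5 =>
    hno (Search.exists_fits_of_common_adj h1 h2 h3 h4 h5)
  have : H.Adj u a → H.Adj v a → H.Adj u b → H.Adj v b → H.Adj u c → H.Adj v c → False := fun h1 h2 h3 h4 h5 h6 =>
    hno (Search.exists_fits_of_three_common h1 h2 h3 h4 h5 h6 nab nac nbc)
  have : H.Adj u a → H.Adj v a → H.Adj u b → H.Adj v b → H.Adj u d → H.Adj v d → False := fun h1 h2 h3 h4 h5 h6 =>
    hno (Search.exists_fits_of_three_common h1 h2 h3 h4 h5 h6 nab nad nbd)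
  have : H.Adj u a → H.Adj v a → H.Adj u c → H.Adj v c → H.Adj u d → H.Adj v d → False := fun h1 h2 h3 h4 h5 h6 =>
    hno (Search.exists_fits_of_three_common h1 h2 h3 h4 h5 h6 nac nad ncd)
  have : H.Adj u b → H.Adj v b → H.Adj u c → H.Adj v c → H.Adj u d → H.Adj v d → False := fun h1 h2 h3 h4 h5 h6 =>
    hno (Search.exists_fits_of_three_common h1 h2 h3 h4 h5 h6 nbc nbd ncd)
  have : H.Adj u a → H.Adj v a → H.Adj u c → H.Adj a c → H.Adj u d → H.Adj a d → False := fun h1 h2 h3 h4 h5 h6 =>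
    hno (Search.exists_fits_of_spoke h1 h2 h3 h4 h5 h6 hvc hvd ncd)
  have : H.Adj u a → H.Adj v a → H.Adj v c → H.Adj a c → H.Adj v d → H.Adj a d → False := fun h1 h2 h3 h4 h5 h6 =>
    hno (Search.exists_fits_of_spoke' h1 h2 h3 h4 h5 h6 huc hud ncd)
  have : H.Adj u b → H.Adj v b → H.Adj u c → H.Adj b c → H.Adj u d → H.Adj b d → False := fun h1 h2 h3 h4 h5 h6 =>
    hno (Search.exists_fits_of_spoke h1 h2 h3 h4 h5 h6 hvc hvd ncd)
  have : H.Adj u b → H.Adj v b → H.Adj v c → H.Adj b c → H.Adj v d → H.Adj b d → False := fun h1 h2 h3 h4 h5 h6 =>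
    hno (Search.exists_fits_of_spoke' h1 h2 h3 h4 h5 h6 huc hud ncd)
  have : H.Adj u c → H.Adj v c → H.Adj u a → H.Adj c a → H.Adj u b → H.Adj c b → False := fun h1 h2 h3 h4 h5 h6 =>
    hno (Search.exists_fits_of_spoke h1 h2 h3 h4 h5 h6 hva hvb nab)
  have : H.Adj u c → H.Adj v c → H.Adj v a → H.Adj c a → H.Adj v b → H.Adj c b → False := fun h1 h2 h3 h4 h5 h6 =>
    hno (Search.exists_fits_of_spoke' h1 h2 h3 h4 h5 h6 hua hub nab)
  have : H.Adj u d → H.Adj v d → H.Adj u a → H.Adj d a → H.Adj u b → H.Adj d b → False := fun h1 h2 h3 h4 h5 h6 =>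
    hno (Search.exists_fits_of_spoke h1 h2 h3 h4 h5 h6 hva hvb nab)
  have : H.Adj u d → H.Adj v d → H.Adj v a → H.Adj d a → H.Adj v b → H.Adj d b → False := fun h1 h2 h3 h4 h5 h6 =>
    hno (Search.exists_fits_of_spoke' h1 h2 h3 h4 h5 h6 hua hub nab)
  have : H.Adj u a → H.Adj u b → H.Adj v c → H.Adj v d → H.Adj a c → H.Adj a d → H.Adj b c → H.Adj b d → False := fun h1 h2 h3 h4 h5 h6 h7 h8 =>
    hno (Search.exists_fits_of_cross h1 h2 h3 h4 h5 h6 h7 h8 hva hvb huc hud nab ncd)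
  have : H.Adj u c → H.Adj u d → H.Adj v a → H.Adj v b → H.Adj c a → H.Adj c b → H.Adj d a → H.Adj d b → False := fun h1 h2 h3 h4 h5 h6 h7 h8 =>
    hno (Search.exists_fits_of_cross h1 h2 h3 h4 h5 h6 h7 h8 hvc hvd hua hub ncd nab)
  have := H.adj_comm a c
  have := H.adj_comm a d
  have := H.adj_comm b c
  have := H.adj_comm b d
  clear key hno h
  grind

/-- If every matching of `G` on `{u, v, a, b, c, d}` uses the edge `uv`, then the complement of
`G` completes a pattern at `u` and `v`. -/
theorem exists_fits_of_not_hasMatchingOn {u v a b c d : V} (h : [u, v, a, b, c, d].Nodup)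
    (hab : G.Adj a b) (hcd : G.Adj c d)
    (hW : ¬ (G.deleteEdges {s(u, v)}).HasMatchingOn {u, v, a, b, c, d})
    (hu : ∀ s : Finset V, (∀ x ∈ s, Gᶜ.Adj u x) → s.card ≤ 3)
    (hv : ∀ s : Finset V, (∀ x ∈ s, Gᶜ.Adj v x) → s.card ≤ 3) :
    ∃ P ∈ Search.patterns, Search.Fits Gᶜ P [u, v] := by
  classical
  -- With degree at most three, neither `u` nor `v` becomes the centre of a `K_{1,5}`.
  have hK : ∀ z : V, (∀ s : Finset V, (∀ x ∈ s, Gᶜ.Adj z x) → s.card ≤ 3) →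
      ¬ (Gᶜ.Adj z a ∧ Gᶜ.Adj z b ∧ Gᶜ.Adj z c ∧ Gᶜ.Adj z d) := by
    rintro z hz ⟨h1, h2, h3, h4⟩
    have := hz [a, b, c, d].toFinset (by simp [-compl_adj, h1, h2, h3, h4])
    rw [List.toFinset_card_of_nodup (by
      simp only [List.nodup_cons] at h ⊢
      exact h.2.2)] at this
    simp at this
  refine exists_fits_of_forall_or h (fun h => h.2 hab) (fun h => h.2 hcd) (hK u hu) (hK v hv) ?_
  intro p q r s hsub hpq hpr hps hqr hqs hrs
  by_contra! hcon
  have hperm : [p, q, r, s].Perm [a, b, c, d] :=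
    (List.Nodup.subperm (by simp [hpq, hpr, hps, hqr, hqs, hrs]) hsub).perm_of_length_le le_rfl
  have hperm' : [u, p, v, q, r, s].Perm [u, v, a, b, c, d] :=
    (List.Perm.swap v p [q, r, s]).cons u |>.trans ((hperm.cons v).cons u)
  have hset : ({u, p, v, q, r, s} : Set V) = {u, v, a, b, c, d} := by
    ext x
    simpa using hperm'.mem_iff (a := x)
  have hnd := hperm'.nodup_iff.2 h
  simp only [compl_adj, not_and, not_not] at hcon
  have h1 := hnd
  simp only [List.nodup_cons, List.mem_cons, List.not_mem_nil, or_false, not_or] at h1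
  refine hW (hset ▸ hasMatchingOn_six hnd ?_ ?_ ?_)
  all_goals rw [deleteEdges_adj, Set.mem_singleton_iff, Sym2.eq_iff]
  · exact ⟨hcon.1 (by tauto), by tauto⟩
  · exact ⟨hcon.2.1 (by tauto), by tauto⟩
  · exact ⟨hcon.2.2 (by tauto), by tauto⟩

end SimpleGraph

/-! ### From the searches to the theorem -/

namespace SimpleGraph

variable {V : Type*}

namespace Search

variable {H : SimpleGraph V} {T : Set V}

theorem realizes_of_nodup {l : List V} (hl : l.Nodup) (hT : ∀ x ∈ l, x ∈ T) (x₀ : V) :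
    Realizes H T l.length l.length 0 0 fun i => l.getD i x₀ := by
  have hzero : ∀ i j, adj 0 i j = true → False := fun i j h => by
    rw [adj_eq_testBit, Nat.zero_testBit] at h
    cases h
  refine ⟨fun i hi j hj hij => ?_, fun i hi => ?_, le_rfl, fun i _ j _ h => (hzero i j h).elim,
    fun i _ j _ h => (hzero i j h).elim⟩
  · simp only [List.getD_eq_getElem _ _ hi, List.getD_eq_getElem _ _ hj] at hij
    exact (hl.getElem_inj_iff).1 hij
  · simp only [List.getD_eq_getElem _ _ hi]
    exact hT _ (List.getElem_mem hi)

theorem IsSaturated.not_path (hH : IsSaturated H T) {p q r s : V} (hT : ∀ x ∈ [p, q, r, s], x ∈ T)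
    (hpq : H.Adj p q) (hqr : H.Adj q r) (hrs : H.Adj r s) (hpr : ¬ H.Adj p r)
    (hqs : ¬ H.Adj q s) (hps : ¬ H.Adj p s) (hpr' : p ≠ r) (hqs' : q ≠ s) (hps' : p ≠ s) :
    False := by
  have h : Realizes H T 4 4 0 0 _ :=
    realizes_of_nodup (by simp [hpq.ne, hqr.ne, hrs.ne, hpr', hqs', hps']) hT p
  have h1 := h.link (by decide) (a := 0) (b := 1) (by decide) (by decide) hpq
  have h2 := h1.link (by decide) (a := 1) (b := 2) (by decide) (by decide) hqr
  have h3 := h2.link (by decide) (a := 2) (b := 3) (by decide) (by decide) hrs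
  have h4 := h3.link_nonedge (by decide) (a := 0) (b := 2) (by decide) (by decide) hpr
  have h5 := h4.link_nonedge (by decide) (a := 1) (b := 3) (by decide) (by decide) hqs
  have h6 := h5.link_nonedge (by decide) (a := 0) (b := 3) (by decide) (by decide) hps
  exact refute_sound hH _ (by decide) refute_path h6

theorem IsSaturated.not_triangle (hH : IsSaturated H T) {p q r s t : V}
    (hT : ∀ x ∈ [p, q, r, s, t], x ∈ T) (hnd : [p, q, r, s, t].Nodup) (hpq : H.Adj p q)
    (hqr : H.Adj q r) (hpr : H.Adj p r) : False := by
  have h : Realizes H T 5 5 0 0 _ := realizes_of_nodup hnd hT p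
  have h1 := h.link (by decide) (a := 0) (b := 1) (by decide) (by decide) hpq
  have h2 := h1.link (by decide) (a := 1) (b := 2) (by decide) (by decide) hqr
  have h3 := h2.link (by decide) (a := 0) (b := 2) (by decide) (by decide) hpr
  exact refute_sound hH _ (by decide) refute_triangle h3

theorem IsSaturated.not_independent (hH : IsSaturated H T) {p q r s t : V}
    (hT : ∀ x ∈ [p, q, r, s, t], x ∈ T) (hnd : [p, q, r, s, t].Nodup) (hpq : ¬ H.Adj p q)
    (hqr : ¬ H.Adj q r) (hpr : ¬ H.Adj p r) : False := by
  have h : Realizes H T 5 5 0 0 _ := realizes_of_nodup hnd hT p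
  have h1 := h.link_nonedge (by decide) (a := 0) (b := 1) (by decide) (by decide) hpq
  have h2 := h1.link_nonedge (by decide) (a := 1) (b := 2) (by decide) (by decide) hqr
  have h3 := h2.link_nonedge (by decide) (a := 0) (b := 2) (by decide) (by decide) hpr
  exact refute_sound hH _ (by decide) refute_independent h3

end Search

/-- On five vertices, a graph without triangles and without three independent vertices contains an
induced path on four vertices. -/
theorem exists_induced_path (H : SimpleGraph V) {S : Finset V} (hS : S.card = 5)
    (htri : ∀ x ∈ S, ∀ y ∈ S, ∀ z ∈ S, H.Adj x y → H.Adj y z → H.Adj x z → False)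
    (hind : ∀ x ∈ S, ∀ y ∈ S, ∀ z ∈ S, x ≠ y → y ≠ z → x ≠ z →
      H.Adj x y ∨ H.Adj y z ∨ H.Adj x z) :
    ∃ p ∈ S, ∃ q ∈ S, ∃ r ∈ S, ∃ s ∈ S, H.Adj p q ∧ H.Adj q r ∧ H.Adj r s ∧ ¬ H.Adj p r ∧
      ¬ H.Adj q s ∧ ¬ H.Adj p s ∧ p ≠ r ∧ q ≠ s ∧ p ≠ s := by
  classical
  obtain ⟨a, ha⟩ : S.Nonempty := Finset.card_pos.1 (by omega)
  have hcard := Finset.card_filter_add_card_filter_not (s := S.erase a) (fun x => H.Adj a x)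
  rw [Finset.card_erase_of_mem ha, hS] at hcard
  -- Three neighbours of `a` are not independent, and an edge among them closes a triangle with `a`;
  -- dually for three non-neighbours. So `a` has two of each.
  have hA : {x ∈ S.erase a | H.Adj a x}.card ≤ 2 := by
    by_contra! h
    obtain ⟨x, y, z, hx, hy, hz, hxy, hxz, hyz⟩ := Finset.two_lt_card_iff.1 h
    simp only [Finset.mem_filter, Finset.mem_erase] at hx hy hz
    rcases hind x hx.1.2 y hy.1.2 z hz.1.2 hxy hyz hxz with h | h | h
    · exact htri a ha x hx.1.2 y hy.1.2 hx.2 h hy.2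
    · exact htri a ha y hy.1.2 z hz.1.2 hy.2 h hz.2
    · exact htri a ha x hx.1.2 z hz.1.2 hx.2 h hz.2
  have hB : {x ∈ S.erase a | ¬ H.Adj a x}.card ≤ 2 := by
    by_contra! h
    obtain ⟨x, y, z, hx, hy, hz, hxy, hxz, hyz⟩ := Finset.two_lt_card_iff.1 h
    simp only [Finset.mem_filter, Finset.mem_erase] at hx hy hz
    have h1 := hind a ha x hx.1.2 y hy.1.2 hx.1.1.symm hxy hy.1.1.symm
    have h2 := hind a ha x hx.1.2 z hz.1.2 hx.1.1.symm hxz hz.1.1.symm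
    have h3 := hind a ha y hy.1.2 z hz.1.2 hy.1.1.symm hyz hz.1.1.symm
    exact htri x hx.1.2 y hy.1.2 z hz.1.2 (by tauto) (by tauto) (by tauto)
  obtain ⟨b, c, hbc, hA⟩ :=
    Finset.card_eq_two.1 (show {x ∈ S.erase a | H.Adj a x}.card = 2 by omega)
  obtain ⟨d, e, hde, hB⟩ :=
    Finset.card_eq_two.1 (show {x ∈ S.erase a | ¬ H.Adj a x}.card = 2 by omega)
  have hb : b ∈ {x ∈ S.erase a | H.Adj a x} := by simp [hA]
  have hc : c ∈ {x ∈ S.erase a | H.Adj a x} := by simp [hA]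
  have hd : d ∈ {x ∈ S.erase a | ¬ H.Adj a x} := by simp [hB]
  have he : e ∈ {x ∈ S.erase a | ¬ H.Adj a x} := by simp [hB]
  simp only [Finset.mem_filter, Finset.mem_erase] at hb hc hd he
  have hbc' : ¬ H.Adj b c := fun h => htri a ha b hb.1.2 c hc.1.2 hb.2 h hc.2
  have hde' : H.Adj d e := by
    have := hind a ha d hd.1.2 e he.1.2 hd.1.1.symm hde he.1.1.symm
    tauto
  have hne : ∀ {x y}, H.Adj a x → ¬ H.Adj a y → x ≠ y := fun h1 h2 h => h2 (h ▸ h1)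
  have path : ∀ d ∈ S, ¬ H.Adj a d → d ≠ a → H.Adj b d → ¬ H.Adj c d →
      ∃ p ∈ S, ∃ q ∈ S, ∃ r ∈ S, ∃ s ∈ S, H.Adj p q ∧ H.Adj q r ∧ H.Adj r s ∧ ¬ H.Adj p r ∧
        ¬ H.Adj q s ∧ ¬ H.Adj p s ∧ p ≠ r ∧ q ≠ s ∧ p ≠ s := fun d hd had hda hbd hcd =>
    ⟨d, hd, b, hb.1.2, a, ha, c, hc.1.2, hbd.symm, hb.2.symm, hc.2, fun h => had h.symm, hbc',
      fun h => hcd h.symm, hda, hbc, (hne hc.2 had).symm⟩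
  -- Each of `d`, `e` is adjacent to `b` or `c`, while neither `b` nor `c` is adjacent to both. So
  -- `b` has a neighbour among `d`, `e` that `c` misses, and it starts a path through `b`, `a`, `c`.
  have h1 := hind b hb.1.2 c hc.1.2 d hd.1.2 hbc (hne hc.2 hd.2) (hne hb.2 hd.2)
  have h2 := hind b hb.1.2 c hc.1.2 e he.1.2 hbc (hne hc.2 he.2) (hne hb.2 he.2)
  have h3 := fun h => htri b hb.1.2 d hd.1.2 e he.1.2 h hde'
  have h4 := fun h => htri c hc.1.2 d hd.1.2 e he.1.2 h hde'
  by_cases hbd : H.Adj b d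
  · by_cases hcd : H.Adj c d
    · tauto
    · exact path d hd.1.2 hd.2 hd.1.1 hbd hcd
  · by_cases hbe : H.Adj b e
    · by_cases hce : H.Adj c e
      · tauto
      · exact path e he.1.2 he.2 he.1.1 hbe hce
    · tauto

variable {G : SimpleGraph V}

/-- For an edge `uv` of `G`, minimality gives a six-set whose matchings in `G` all use `uv`. One
such matching `uv`, `ab`, `cd` names the six vertices. -/
theorem isSaturated_compl [Fintype V] (hV : 7 ≤ Fintype.card V)
    (hG : G.IsMinimallyFactorCritical (Fintype.card V - 6)) {T : Set V}
    (hT : ∀ v ∈ T, ∀ s : Finset V, (∀ x ∈ s, Gᶜ.Adj v x) → s.card ≤ 3) :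
    Search.IsSaturated Gᶜ T := by
  classical
  obtain ⟨hfc, hmin⟩ := hG
  rw [isFactorCritical_card_sub_iff G (by decide) (by omega)] at hfc
  refine ⟨card_le_four_of_compl_adj hfc, hT, fun x y => card_le_two_of_compl_adj hfc (by omega),
    fun x y a b => not_compl_adj_of_triangles hfc (by omega),
    fun x y z => card_le_two_of_compl_adj_three hfc, fun u hu v hv huv hadj => ?_⟩
  have hadj : G.Adj u v := by
    by_contra h
    exact hadj ⟨huv, h⟩
  have hmin := hmin s(u, v) hadj
  rw [isFactorCritical_card_sub_iff _ (by decide) (by omega)] at hmin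
  push Not at hmin
  obtain ⟨W, hW, hno⟩ := hmin
  obtain ⟨σ, hσ⟩ := hfc W hW
  simp only [Finset.mem_coe] at hσ
  -- A matching avoiding `uv` would survive the deletion of that edge.
  obtain ⟨huW, huσ⟩ : u ∈ W ∧ σ u = v := by
    by_contra hcon
    refine hno ⟨σ, fun w hw => ⟨(hσ w hw).1, ?_, (hσ w hw).2.2⟩⟩
    rw [deleteEdges_adj, Set.mem_singleton_iff, Sym2.eq_iff]
    refine ⟨(hσ w hw).2.1, ?_⟩
    rintro (⟨rfl, h⟩ | ⟨rfl, h⟩)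
    · exact hcon ⟨hw, h⟩
    · exact hcon ⟨h ▸ (hσ w hw).1, h ▸ (hσ w hw).2.2⟩
  have hvW : v ∈ W := huσ ▸ (hσ u huW).1
  have hvσ : σ v = u := huσ ▸ (hσ u huW).2.2
  have hinj : ∀ x ∈ W, ∀ y ∈ W, σ x = y → σ y = x := fun x hx y hy h => h ▸ (hσ x hx).2.2
  have hsub : ({u, v} : Finset V) ⊆ W := by simp [Finset.insert_subset_iff, huW, hvW]
  have hcard : (W \ {u, v}).card = 4 := by
    rw [Finset.card_sdiff_of_subset hsub, hW, Finset.card_pair huv]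
  obtain ⟨a, ha⟩ : (W \ {u, v}).Nonempty := Finset.card_pos.1 (by omega)
  simp only [Finset.mem_sdiff, Finset.mem_insert, Finset.mem_singleton, not_or] at ha
  obtain ⟨b, hb⟩ : ∃ b, σ a = b := ⟨_, rfl⟩
  have hab := hb ▸ (hσ a ha.1).2.1
  have hbW := hb ▸ (hσ a ha.1).1
  have hbu : b ≠ u := fun h => ha.2.2 (by rw [← huσ, ← h, hinj a ha.1 b hbW hb])
  have hbv : b ≠ v := fun h => ha.2.1 (by rw [← hvσ, ← h, hinj a ha.1 b hbW hb])
  have hsub : ({u, v, a, b} : Finset V) ⊆ W := by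
    simp [Finset.insert_subset_iff, huW, hvW, ha.1, hbW]
  have hcard : (W \ {u, v, a, b}).card = 2 := by
    rw [Finset.card_sdiff_of_subset hsub, hW, Finset.card_insert_of_notMem,
      Finset.card_insert_of_notMem, Finset.card_pair hab.ne]
    · simp [Ne.symm ha.2.2, hbv.symm]
    · simp [huv, Ne.symm ha.2.1, hbu.symm]
  obtain ⟨c, d, hcd, hWcd⟩ := Finset.card_eq_two.1 hcard
  have hc : c ∈ W \ {u, v, a, b} := by simp [hWcd]
  have hd : d ∈ W \ {u, v, a, b} := by simp [hWcd]
  simp only [Finset.mem_sdiff, Finset.mem_insert, Finset.mem_singleton, not_or] at hc hd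
  have hWeq : (W : Set V) = {u, v, a, b, c, d} := by
    rw [← Finset.union_sdiff_of_subset hsub, hWcd]
    ext x
    simp only [Finset.coe_union, Finset.coe_insert, Finset.coe_singleton, Set.mem_union,
      Set.mem_insert_iff, Set.mem_singleton_iff]
    tauto
  have hcσ : σ c = d := by
    have h1 := (hσ c hc.1).1
    have h2 : σ c ∈ (W : Set V) := h1
    rw [hWeq] at h2
    simp only [Set.mem_insert_iff, Set.mem_singleton_iff] at h2
    rcases h2 with h | h | h | h | h | h
    · exact absurd (hinj c hc.1 u huW h ▸ huσ) hc.2.2.1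
    · exact absurd (hinj c hc.1 v hvW h ▸ hvσ) hc.2.1
    · exact absurd (hinj c hc.1 a ha.1 h ▸ hb) hc.2.2.2.2
    · exact absurd (hinj c hc.1 b hbW h ▸ hinj a ha.1 b hbW hb) hc.2.2.2.1
    · exact absurd h.symm (hσ c hc.1).2.1.ne
    · exact h
  have hcd' := hcσ ▸ (hσ c hc.1).2.1
  rw [hWeq] at hno
  refine exists_fits_of_not_hasMatchingOn ?_ hab hcd' hno (hT u hu) (hT v hv)
  have := hab.ne
  simp only [List.nodup_cons, List.mem_cons, List.not_mem_nil, or_false, not_or]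
  simp [huv, this, hcd, Ne.symm ha.2.1, Ne.symm ha.2.2, hbu.symm, hbv.symm, Ne.symm hc.2.1,
    Ne.symm hc.2.2.1, Ne.symm hc.2.2.2.1, Ne.symm hc.2.2.2.2, Ne.symm hd.2.1,
    Ne.symm hd.2.2.1, Ne.symm hd.2.2.2.1, Ne.symm hd.2.2.2.2]

/-- The set counted is the neighbourhood of `v` in the complement. -/
theorem card_compl_insert_neighborFinset [Fintype V] [DecidableEq V] [DecidableRel G.Adj] (v : V) :
    (insert v (G.neighborFinset v))ᶜ.card = Fintype.card V - (G.degree v + 1) := by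
  rw [Finset.card_compl, Finset.card_insert_of_notMem (by simp), card_neighborFinset_eq_degree]

theorem _root_.Finset.exists_notMem_and_notMem_of_card {S : Finset V} (hS : S.card = 5)
    {x y z : V} (hx : x ∈ S) (hy : y ∈ S) (hz : z ∈ S) (hxy : x ≠ y) (hyz : y ≠ z)
    (hxz : x ≠ z) : ∃ s ∈ S, ∃ t ∈ S, [x, y, z, s, t].Nodup := by
  classical
  have hsub : ({x, y, z} : Finset V) ⊆ S := by simp [Finset.insert_subset_iff, hx, hy, hz]
  have hcard : (S \ {x, y, z}).card = 2 := by
    rw [Finset.card_sdiff_of_subset hsub, hS, Finset.card_insert_of_notMem, Finset.card_pair hyz]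
    simp [hxy, hxz]
  obtain ⟨s, t, hst, h⟩ := Finset.card_eq_two.1 hcard
  have hs : s ∈ S \ {x, y, z} := by simp [h]
  have ht : t ∈ S \ {x, y, z} := by simp [h]
  simp only [Finset.mem_sdiff, Finset.mem_insert, Finset.mem_singleton, not_or] at hs ht
  exact ⟨s, hs.1, t, ht.1, by simp [hxy, hyz, hxz, hst, Ne.symm hs.2.1, Ne.symm hs.2.2.1,
    Ne.symm hs.2.2.2, Ne.symm ht.2.1, Ne.symm ht.2.2.1, Ne.symm ht.2.2.2]⟩

theorem Search.IsSaturated.card_le_four {H : SimpleGraph V} {T : Set V}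
    (hH : Search.IsSaturated H T) {S : Finset V} (hS : ∀ x ∈ S, x ∈ T) : S.card ≤ 4 := by
  by_contra! hcard
  obtain ⟨S', hSS', hS'⟩ := Finset.exists_subset_card_eq hcard
  replace hS : ∀ x ∈ S', x ∈ T := fun x hx => hS x (hSS' hx)
  obtain ⟨p, hp, q, hq, r, hr, s, hs, h1, h2, h3, h4, h5, h6, h7, h8, h9⟩ :=
    exists_induced_path H hS'
      (fun x hx y hy z hz hxy hyz hxz => by
        obtain ⟨s, hs, t, ht, hnd⟩ :=
          Finset.exists_notMem_and_notMem_of_card hS' hx hy hz hxy.ne hyz.ne hxz.ne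
        exact hH.not_triangle (by simp [hS, hx, hy, hz, hs, ht]) hnd hxy hyz hxz)
      (fun x hx y hy z hz hxy hyz hxz => by
        by_contra! hno
        obtain ⟨s, hs, t, ht, hnd⟩ :=
          Finset.exists_notMem_and_notMem_of_card hS' hx hy hz hxy hyz hxz
        exact hH.not_independent (by simp [hS, hx, hy, hz, hs, ht]) hnd hno.1 hno.2.1 hno.2.2)
  exact hH.not_path (by simp [hS, hp, hq, hr, hs]) h1 h2 h3 h4 h5 h6 h7 h8 h9

end SimpleGraph

theorem theorem5p5 {V : Type*} [Fintype V] (G : SimpleGraph V) [DecidableRel G.Adj] (n : ℕ)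
    (hn : 11 ≤ n) (hV : Fintype.card V = n) (hG : G.IsMinimallyFactorCritical (n - 6))
    (hΔ : G.maxDegree = n - 4) :
    {v : V | G.degree v = n - 4}.ncard ≤ 4 ∧
      (∀ v : V, G.degree v ≠ n - 4 → G.degree v = n - 5) ∧
      ¬ ∃ p : SimpleGraph.pathGraph 4 ↪g G, ∀ i : Fin 4, G.degree (p i) = n - 4 := by
  classical
  subst hV
  have hH : SimpleGraph.Search.IsSaturated Gᶜ {v : V | G.degree v = Fintype.card V - 4} := by
    refine SimpleGraph.isSaturated_compl (by omega) hG fun v hv s hs => ?_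
    have hv : G.degree v = Fintype.card V - 4 := hv
    have : s ⊆ (insert v (G.neighborFinset v))ᶜ := fun x hx => by
      have := hs x hx
      simp only [Finset.mem_compl, Finset.mem_insert, SimpleGraph.mem_neighborFinset, not_or]
      exact ⟨this.ne', this.2⟩
    have := Finset.card_le_card this
    rw [SimpleGraph.card_compl_insert_neighborFinset] at this
    omega
  refine ⟨?_, fun v hv => ?_, ?_⟩
  · rw [Set.ncard_eq_toFinset_card']
    exact hH.card_le_four fun x hx => by simpa using hx
  -- The maximum degree bounds the degree above by `n - 4`; the absence of `K_{1,5}` in the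
  -- complement bounds it below by `n - 5`.
  · have h1 := G.degree_le_maxDegree v
    have h2 := hH.degree_le v (insert v (G.neighborFinset v))ᶜ fun x hx => by
      simp only [Finset.mem_compl, Finset.mem_insert, SimpleGraph.mem_neighborFinset, not_or] at hx
      exact ⟨Ne.symm hx.1, hx.2⟩
    rw [SimpleGraph.card_compl_insert_neighborFinset] at h2
    omega
  · rintro ⟨p, hp⟩
    have hadj : ∀ i j, Gᶜ.Adj (p i) (p j) ↔ i ≠ j ∧ ¬ (SimpleGraph.pathGraph 4).Adj i j := by
      intro i j
      rw [SimpleGraph.compl_adj, p.map_adj_iff, p.injective.ne_iff]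
    have hne : ∀ i j, p i ≠ p j ↔ i ≠ j := fun i j => p.injective.ne_iff
    -- The complement of the path 0, 1, 2, 3 is the path 2, 0, 3, 1.
    refine hH.not_path (p := p 2) (q := p 0) (r := p 3) (s := p 1) ?_ ?_ ?_ ?_ ?_ ?_ ?_ ?_ ?_ ?_
    · simp [hp]
    all_goals simp only [hadj, hne, SimpleGraph.pathGraph_adj]
    all_goals decide
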